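/- **Games.** An XOR game $G=(f,\pi)$ consists of finite sets $S,T$, a function $f:S\times T\to\{0,1\}$ and a probability distribution $\pi$ on $S\times T$; on questions $(s,t)$ drawn from $\pi$, Alice receives $s$, Bob receives $t$, they answer with bits $a,b$ and win iff $a\oplus b=f(s,t)$. For XOR games $G_i=(f_i,\pi_i)$ on $S_i\times T_i$ ($1\le i\le n$), the conjunction $\wedge_{i=1}^nG_i$ is the game with question sets $S=\prod_iS_i$, $T=\prod_iT_i$, distribution $\pi(s,t)=\prod_i\pi_i(s_i,t_i)$, answer sets $A=B=\{0,1\}^n$, and winning predicate $V(a,b|s,t)=1$ if $a_i\oplus b_i=f_i(s_i,t_i)$ for all $i$, and $V(a,b|s,t)=0$ otherwise. **Values.** Let $G$ be a game with finite question sets $S,T$, finite answer sets $A,B$, distribution $\pi$ and predicate $V$. * The quantum value $\omega_q(G)$ is the maximum of $$\sum_{s,t}\pi(s,t)\sum_{a,b}V(a,b|s,t)\,\langle\psi|M_s^a\otimes N_t^b|\psi\rangle$$ over all finite-dimensional complex Hilbert spaces $\mathcal A,\mathcal B$, unit vectors $|\psi\rangle\in\mathcal A\otimes\mathcal B$, and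 POVMs $\{M_s^a\}_{a\in A}$ on $\mathcal A$ ($s\in S$) and $\{N_t^b\}_{b\in B}$ on $\mathcal B$ ($t\in T$). * Let $C_{(s,a),(t,b)}=\pi(s,t)V(a,b|s,t)$ and $\hat C=\frac12\begin{pmatrix}0&C\\C^T&0\end{pmatrix}$. The first Feige–Lovász relaxation $\sigma(G)$ is the maximum of $\operatorname{Tr}(\hat CP)$ over real symmetric positive semidefinite matrices $P$, indexed by the disjoint union of $S\times A$ and $T\times B$, all of whose entries are nonnegative and such that, for all $s,t$ in the disjoint union $S\sqcup T$, $\sum_{a,b}P_{(s,a),(t,b)}=1$, where $a$ and $b$ run over the answers to the questions $s$ and $t$, respectively. * The second Feige–Lovász relaxation $\bar\sigma(G)$ is the maximum of $\operatorname{Tr}(\hat CP)$ over real symmetric positive semidefinite matrices $P$ with the same index set such that $\sum_{a,b}|P_{(s,a),(t,b)}|\le1$ whenever $s,t\in S$ or $s,t\in T$, and $P_{(s,a),(t,b)}\ge0$ for all $s\in S$, $t\in T$, $a\in A$, $b\in B$. **Proposition.** For any XOR games $G_1,\dots,G_n$, the three maxima for the game $\wedge_{i=1}^nG_i$ are attained,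 and $$\omega_q(\wedge_{i=1}^nG_i)=\sigma(\wedge_{i=1}^nG_i)=\bar\sigma(\wedge_{i=1}^nG_i).$$ -/

import Mathlib

open scoped Kronecker Matrix ComplexOrder

/-- A two-prover one-round game with finite question sets `S`, `T` and finite answer sets `A`, `B`:
a probability distribution `π` on `S × T` and a `{0,1}`-valued predicate `V(a,b|s,t)`. -/
structure TwoProverGame (S T A B : Type*) [Fintype S] [Fintype T] where
  π : S → T → ℝ
  π_nonneg : ∀ s t, 0 ≤ π s t
  π_sum : ∑ s, ∑ t, π s t = 1
  V : S → T → A → B → Bool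

/-- An XOR game `(f, π)`: the answers are bits, and the provers win iff `a ⊕ b = f(s,t)`. -/
structure XORGame (S T : Type*) [Fintype S] [Fintype T] where
  f : S → T → Bool
  π : S → T → ℝ
  π_nonneg : ∀ s t, 0 ≤ π s t
  π_sum : ∑ s, ∑ t, π s t = 1

/-- The conjunction of finitely many XOR games: all of them are played simultaneously, with
independent question pairs, and the provers have to win every one of them. -/
def XORGame.conjunction {n : ℕ} {S T : Fin n → Type*} [∀ i, Fintype (S i)] [∀ i, Fintype (T i)]
    (G : ∀ i, XORGame (S i) (T i)) :
    TwoProverGame (∀ i, S i) (∀ i, T i) (Fin n → Bool) (Fin n → Bool) where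
  π s t := ∏ i, (G i).π (s i) (t i)
  π_nonneg s t := Finset.prod_nonneg fun i _ => (G i).π_nonneg _ _
  π_sum := by
    simp only [← Fintype.prod_sum]
    rw [← Fintype.prod_sum (fun i x => ∑ j, (G i).π x j)]
    exact Finset.prod_eq_one fun i _ => (G i).π_sum
  V s t a b := decide (∀ i, xor (a i) (b i) = (G i).f (s i) (t i))

/-- A quantum strategy: a shared pure state `ψ ∈ ℂ^dA ⊗ ℂ^dB`, and for each question a POVM
on Alice's, respectively Bob's, part of the state, indexed by the answers. -/
structure QuantumStrategy (S T A B : Type*) [Fintype A] [Fintype B] where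
  dA : ℕ
  dB : ℕ
  ψ : Fin dA × Fin dB → ℂ
  ψ_unit : star ψ ⬝ᵥ ψ = 1
  M : S → A → Matrix (Fin dA) (Fin dA) ℂ
  M_pos : ∀ s a, (M s a).PosSemidef
  M_sum : ∀ s, ∑ a, M s a = 1
  N : T → B → Matrix (Fin dB) (Fin dB) ℂ
  N_pos : ∀ t b, (N t b).PosSemidef
  N_sum : ∀ t, ∑ b, N t b = 1

/-- The probability `⟨ψ| M_s^a ⊗ N_t^b |ψ⟩` of the answers `a`, `b` to the questions `s`, `t`. -/
noncomputable def QuantumStrategy.prob {S T A B : Type*} [Fintype A] [Fintype B]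
    (Q : QuantumStrategy S T A B) (s : S) (t : T) (a : A) (b : B) : ℝ :=
  (star Q.ψ ⬝ᵥ ((Q.M s a ⊗ₖ Q.N t b) *ᵥ Q.ψ)).re

namespace TwoProverGame

variable {S T A B : Type*} [Fintype S] [Fintype T] [Fintype A] [Fintype B]

/-- The success probability of a quantum strategy. -/
noncomputable def successProb (G : TwoProverGame S T A B) (Q : QuantumStrategy S T A B) : ℝ :=
  ∑ s, ∑ t, G.π s t * ∑ a, ∑ b, if G.V s t a b then Q.prob s t a b else 0

/-- The quantum value `ω_q(G)`. -/
noncomputable def quantumValue (G : TwoProverGame S T A B) : ℝ :=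
  sSup (Set.range G.successProb)

/-- The matrix `C` with entries `C_{(s,a),(t,b)} = π(s,t) V(a,b|s,t)`. -/
noncomputable def costMatrix (G : TwoProverGame S T A B) : Matrix (S × A) (T × B) ℝ :=
  Matrix.of fun i j => G.π i.1 j.1 * if G.V i.1 j.1 i.2 j.2 then 1 else 0

/-- The symmetric matrix `Ĉ = ½ [[0, C], [Cᵀ, 0]]`. -/
noncomputable def symCostMatrix (G : TwoProverGame S T A B) :
    Matrix ((S × A) ⊕ (T × B)) ((S × A) ⊕ (T × B)) ℝ :=
  (1 / 2 : ℝ) • Matrix.fromBlocks 0 G.costMatrix G.costMatrixᵀ 0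

/-- The common objective function `Tr(Ĉ P)` of the two Feige–Lovász relaxations. -/
noncomputable def objective (G : TwoProverGame S T A B)
    (P : Matrix ((S × A) ⊕ (T × B)) ((S × A) ⊕ (T × B)) ℝ) : ℝ :=
  (G.symCostMatrix * P).trace

end TwoProverGame

/-- Feasibility for the first Feige–Lovász relaxation. The block sums equal `1` for all pairs of
questions in the disjoint union of `S` and `T`, which is spelled out in four cases. -/
structure FeasibleSigma {S T A B : Type*} [Fintype A] [Fintype B]
    (P : Matrix ((S × A) ⊕ (T × B)) ((S × A) ⊕ (T × B)) ℝ) : Prop where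
  posSemidef : P.PosSemidef
  nonneg : ∀ i j, 0 ≤ P i j
  sum_SS : ∀ s s' : S, ∑ a, ∑ a', P (.inl (s, a)) (.inl (s', a')) = 1
  sum_ST : ∀ (s : S) (t : T), ∑ a, ∑ b, P (.inl (s, a)) (.inr (t, b)) = 1
  sum_TS : ∀ (t : T) (s : S), ∑ b, ∑ a, P (.inr (t, b)) (.inl (s, a)) = 1
  sum_TT : ∀ t t' : T, ∑ b, ∑ b', P (.inr (t, b)) (.inr (t', b')) = 1

/-- Feasibility for the second Feige–Lovász relaxation. -/
structure FeasibleSigmaBar {S T A B : Type*} [Fintype A] [Fintype B]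
    (P : Matrix ((S × A) ⊕ (T × B)) ((S × A) ⊕ (T × B)) ℝ) : Prop where
  posSemidef : P.PosSemidef
  nonneg_ST : ∀ (s : S) (t : T) (a : A) (b : B), 0 ≤ P (.inl (s, a)) (.inr (t, b))
  sum_SS : ∀ s s' : S, ∑ a, ∑ a', |P (.inl (s, a)) (.inl (s', a'))| ≤ 1
  sum_TT : ∀ t t' : T, ∑ b, ∑ b', |P (.inr (t, b)) (.inr (t', b'))| ≤ 1

namespace TwoProverGame

variable {S T A B : Type*} [Fintype S] [Fintype T] [Fintype A] [Fintype B]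

/-- The optimum `σ(G)` of the first Feige–Lovász relaxation. -/
noncomputable def sigma (G : TwoProverGame S T A B) : ℝ :=
  sSup (G.objective '' {P | FeasibleSigma P})

/-- The optimum `σ̄(G)` of the second Feige–Lovász relaxation. -/
noncomputable def sigmaBar (G : TwoProverGame S T A B) : ℝ :=
  sSup (G.objective '' {P | FeasibleSigmaBar P})

end TwoProverGame

/-!
The quantum bias of an XOR game is the maximum of `∑ A s t * Γ s t` over correlation matrices `Γ`,
where `A` is the signed distribution of the game. Strong duality turns an optimal `Γ` into
diagonal matrices `diag p`, `diag q` with `[[diag p, A], [Aᵀ, diag q]]` positive semidefinite and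
`∑ p = ∑ q` equal to the bias. The distribution `π` itself has such a certificate, bordered by its
two marginals, with value one.

The cost matrix of the conjunction is an entrywise product over the games of
`(π ± A) / 2`, so by the Schur product theorem the certificates of the single games multiply to a
positive semidefinite matrix with the cost matrix as its off-diagonal block. Its diagonal blocks
expand in the characters of the group of answers with nonnegative coefficients, and the quadratic
form of each character is at most one on Gram matrices of quantum strategies as well as on solutions
of either relaxation. This bounds all three values by the product of the numbers `(1 + bias) / 2`.
Tsirelson's strategies for the single games, played in parallel, attain this bound, and so does the
corresponding product of correlation matrices.
-/

open Matrix

section PosSemidef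

variable {ι 𝕜 : Type*} [RCLike 𝕜]

lemma posSemidef_finset_prod {κ : Type*} [Finite ι] (s : Finset κ) {M : κ → Matrix ι ι 𝕜}
    (hM : ∀ k ∈ s, (M k).PosSemidef) : (of fun x y => ∏ k ∈ s, M k x y).PosSemidef := by
  classical
  induction s using Finset.induction_on with
  | empty =>
    convert posSemidef_vecMulVec_self_star (1 : ι → 𝕜) using 1
    ext
    simp [vecMulVec_apply]
  | insert k s hk ih =>
    rw [Finset.forall_mem_insert] at hM
    convert hM.1.hadamard (ih hM.2) using 1
    ext
    simp [Finset.prod_insert hk]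

lemma posSemidef_mul_mul_apply [Finite ι] {M : Matrix ι ι ℝ} (hM : M.PosSemidef) (c : ι → ℝ) :
    (of fun i j => c i * c j * M i j).PosSemidef := by
  have heq : vecMulVec c (star c) ⊙ M = of fun i j => c i * c j * M i j := by
    ext
    simp [vecMulVec_apply]
  exact heq ▸ (posSemidef_vecMulVec_self_star c).hadamard hM

lemma isSymm_of_posSemidef {M : Matrix ι ι ℝ} (hM : M.PosSemidef) : M.IsSymm := by
  simpa only [IsSymm, IsHermitian, conjTranspose_eq_transpose_of_trivial] using hM.isHermitian

lemma posSemidef_re_dotProduct {κ : Type*} [Finite ι] [Fintype κ] (w : ι → κ → 𝕜) :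
    (of fun i j => RCLike.re (star (w i) ⬝ᵥ w j)).PosSemidef := by
  convert (posSemidef_conjTranspose_mul_self (of fun k i => RCLike.re (w i k))).add
    (posSemidef_conjTranspose_mul_self (of fun k i => RCLike.im (w i k))) using 1
  ext
  simp [mul_apply, dotProduct, ← Finset.sum_add_distrib]

lemma isClosed_posSemidef [Finite ι] : IsClosed {M : Matrix ι ι 𝕜 | M.PosSemidef} := by
  have := Fintype.ofFinite ι
  simp only [posSemidef_iff_dotProduct_mulVec, IsHermitian, Set.ofPred_and, Set.ofPred_forall]
  exact (isClosed_eq (by fun_prop) continuous_id).inter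
    (isClosed_iInter fun x => isClosed_le continuous_const (by fun_prop))

lemma trace_mul_nonneg_of_posSemidef [Fintype ι] {M P : Matrix ι ι 𝕜} (hM : M.PosSemidef)
    (hP : P.PosSemidef) : 0 ≤ (M * P).trace := by
  have h := (hM.hadamard hP.transpose).dotProduct_mulVec_nonneg 1
  rw [← transpose_transpose P, ← sum_hadamard_eq]
  simpa [dotProduct, mulVec, -hadamard_apply] using h

lemma posSemidef_fromBlocks_neg {m n : Type*} [Finite m] [Finite n] {A : Matrix m m 𝕜}
    {B : Matrix m n 𝕜} {C : Matrix n m 𝕜} {D : Matrix n n 𝕜}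
    (h : (fromBlocks A B C D).PosSemidef) : (fromBlocks A (-B) (-C) D).PosSemidef := by
  classical
  have := Fintype.ofFinite m
  have := Fintype.ofFinite n
  simpa [fromBlocks_multiply, fromBlocks_conjTranspose] using
    h.conjTranspose_mul_mul_same (fromBlocks 1 0 0 (-1) : Matrix (m ⊕ n) (m ⊕ n) 𝕜)

end PosSemidef

section Trace

variable {R m n : Type*} [CommRing R] [Fintype m] [Fintype n]

lemma trace_fromBlocks_diag_mul (U : Matrix m m R) (V : Matrix n n R)
    (P : Matrix (m ⊕ n) (m ⊕ n) R) :
    (fromBlocks U 0 0 V * P).trace = (U * P.toBlocks₁₁).trace + (V * P.toBlocks₂₂).trace := by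
  conv_lhs => rw [← fromBlocks_toBlocks P]
  simp [fromBlocks_multiply, trace]

lemma trace_fromBlocks_offDiag_mul (A : Matrix m n R) {P : Matrix (m ⊕ n) (m ⊕ n) R}
    (hP : P.IsSymm) :
    (fromBlocks 0 A Aᵀ 0 * P).trace = 2 * ∑ i, ∑ j, A i j * P (.inl i) (.inr j) := by
  simp only [trace, diag_apply, mul_apply, Fintype.sum_sum_type, fromBlocks_apply₁₁,
    fromBlocks_apply₁₂, fromBlocks_apply₂₁, fromBlocks_apply₂₂, transpose_apply, Matrix.zero_apply,
    zero_mul, Finset.sum_const_zero, zero_add, add_zero, hP.apply (.inl _) (.inr _)]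
  rw [Finset.sum_comm (s := (Finset.univ : Finset n)), two_mul]

lemma trace_mul_eq_sum_trace_of_blockDiagonal {U : Matrix (m × n) (m × n) R}
    (hU : ∀ s s', s ≠ s' → ∀ a a', U (s, a) (s', a') = 0) (Q : Matrix (m × n) (m × n) R) :
    (U * Q).trace = ∑ s, (U.submatrix (Prod.mk s) (Prod.mk s) *
      Q.submatrix (Prod.mk s) (Prod.mk s)).trace := by
  simp only [trace, diag_apply, mul_apply, submatrix_apply, Fintype.sum_prod_type]
  refine Finset.sum_congr rfl fun s _ => Finset.sum_congr rfl fun a _ =>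
    Finset.sum_eq_single s (fun s' _ hs => ?_) (by simp)
  simp [hU s s' hs.symm]

end Trace

/-! ### Correlation matrices and strong duality -/

/-- Correlation matrices: the Gram matrices of real unit vectors. By Tsirelson's theorem their
entries are the correlations of `±1`-valued observables in a maximally entangled state. -/
structure IsCorrelation {ι : Type*} (Γ : Matrix ι ι ℝ) : Prop where
  posSemidef : Γ.PosSemidef
  diag_eq_one : ∀ i, Γ i i = 1

section Correlation

variable {ι : Type*}

lemma IsCorrelation.abs_apply_le_one {Γ : Matrix ι ι ℝ} (hΓ : IsCorrelation Γ) (i j : ι) :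
    |Γ i j| ≤ 1 := by
  have hdet := (hΓ.posSemidef.submatrix ![i, j]).det_nonneg
  simp only [det_fin_two, submatrix_apply, cons_val_zero, cons_val_one, hΓ.diag_eq_one,
    (isSymm_of_posSemidef hΓ.posSemidef).apply i j] at hdet
  rw [abs_le_one_iff_mul_self_le_one]
  linarith

lemma isCompact_isCorrelation [Finite ι] : IsCompact {Γ : Matrix ι ι ℝ | IsCorrelation Γ} := by
  have hcube : IsCompact (Set.univ.pi fun _ => Set.univ.pi fun _ => Set.Icc (-1) 1 :
      Set (Matrix ι ι ℝ)) :=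
    isCompact_univ_pi fun _ => isCompact_univ_pi fun _ => isCompact_Icc
  refine hcube.of_isClosed_subset ?_ fun Γ hΓ i _ j _ => abs_le.1 (hΓ.abs_apply_le_one i j)
  have hset : {Γ : Matrix ι ι ℝ | IsCorrelation Γ} =
      {Γ | Γ.PosSemidef} ∩ ⋂ i, {Γ | Γ i i = 1} := by
    ext Γ
    simpa using ⟨fun h => ⟨h.1, h.2⟩, fun h => ⟨h.1, h.2⟩⟩
  rw [hset]
  exact isClosed_posSemidef.inter (isClosed_iInter fun i => isClosed_eq (by fun_prop) (by fun_prop))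

lemma isCorrelation_normalize [Finite ι] {M : Matrix ι ι ℝ} (hM : M.PosSemidef)
    (hpos : ∀ i, 0 < M i i) :
    IsCorrelation (of fun i j => (√(M i i))⁻¹ * (√(M j j))⁻¹ * M i j) where
  posSemidef := posSemidef_mul_mul_apply hM _
  diag_eq_one i := by
    rw [of_apply, ← mul_inv, Real.mul_self_sqrt (hpos i).le, inv_mul_cancel₀ (hpos i).ne']

lemma nonpos_of_isMaxOn_Ici {f : ℝ → ℝ} {f' a : ℝ} (hmax : IsMaxOn f (Set.Ici a) a)
    (hf : HasDerivAt f f' a) : f' ≤ 0 := by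
  have hone : (1 : ℝ) ∈ posTangentConeAt (Set.Ici a) a :=
    one_mem_posTangentConeAt_iff_mem_closure.2 <| by
      rw [Set.inter_eq_left.2 Set.Ioi_subset_Ici_self, closure_Ioi]
      exact Set.self_mem_Ici
  simpa using hmax.localize.hasFDerivWithinAt_nonpos hf.hasFDerivAt.hasFDerivWithinAt hone

lemma hasDerivAt_normalized_perturbation (x y g : ℝ) :
    HasDerivAt (fun d => (√(1 + d * x ^ 2))⁻¹ * (√(1 + d * y ^ 2))⁻¹ * (g + d * (x * y)))
      (x * y - (x ^ 2 + y ^ 2) / 2 * g) 0 := by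
  have hlin (b c : ℝ) : HasDerivAt (fun d => b + d * c) c 0 := by
    simpa using ((hasDerivAt_id (0 : ℝ)).mul_const c).const_add b
  have hroot (z : ℝ) : HasDerivAt (fun d => (√(1 + d * z ^ 2))⁻¹) (-(z ^ 2 / 2)) 0 := by
    simpa using ((hlin 1 (z ^ 2)).sqrt (by simp)).fun_inv (by simp)
  refine (((hroot x).fun_mul (hroot y)).fun_mul (hlin g (x * y))).congr_deriv ?_
  simp
  ring

variable [Fintype ι] {B Γ : Matrix ι ι ℝ}

/-- The first-order condition for moving `Γ` towards `x xᵀ` and renormalizing the diagonal. -/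
lemma IsCorrelation.sum_mul_le_of_isMaxOn (hΓ : IsCorrelation Γ)
    (hmax : IsMaxOn (fun M => (B * M).trace) {M | IsCorrelation M} Γ) (x : ι → ℝ) :
    ∑ i, ∑ j, B i j * (x j * x i) ≤ ∑ i, ∑ j, B i j * ((x j ^ 2 + x i ^ 2) / 2 * Γ j i) := by
  let path (d : ℝ) : Matrix ι ι ℝ := of fun i j =>
    (√(1 + d * x i ^ 2))⁻¹ * (√(1 + d * x j ^ 2))⁻¹ * (Γ i j + d * (x i * x j))
  have hpath_zero : path 0 = Γ := by ext; simp [path]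
  have hpath (d : ℝ) (hd : 0 ≤ d) : IsCorrelation (path d) := by
    convert isCorrelation_normalize (M := Γ + d • vecMulVec x (star x))
      (hΓ.posSemidef.add ((posSemidef_vecMulVec_self_star x).smul hd)) fun i => ?_ using 1
    · ext i j
      simp [path, vecMulVec_apply, hΓ.diag_eq_one, sq]
    · simp only [Matrix.add_apply, Matrix.smul_apply, vecMulVec_apply, hΓ.diag_eq_one,
        star_trivial, smul_eq_mul]
      nlinarith [mul_nonneg hd (mul_self_nonneg (x i))]
  have hderiv : HasDerivAt (fun d => (B * path d).trace)
      (∑ i, ∑ j, B i j * (x j * x i - (x j ^ 2 + x i ^ 2) / 2 * Γ j i)) 0 :=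
    HasDerivAt.fun_sum fun i _ => HasDerivAt.fun_sum fun j _ =>
      (hasDerivAt_normalized_perturbation (x j) (x i) (Γ j i)).const_mul (B i j)
  have hnonpos := nonpos_of_isMaxOn_Ici (fun d hd => by
    simpa only [Set.mem_ofPred_eq, hpath_zero] using hmax (hpath d hd)) hderiv
  simpa only [mul_sub, Finset.sum_sub_distrib, sub_nonpos] using hnonpos

theorem IsCorrelation.posSemidef_diagonal_sub_of_isMaxOn [DecidableEq ι] (hΓ : IsCorrelation Γ)
    (hB : B.IsSymm) (hmax : IsMaxOn (fun M => (B * M).trace) {M | IsCorrelation M} Γ) :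
    (diagonal (B * Γ).diag - B).PosSemidef := by
  refine .of_dotProduct_mulVec_nonneg ((isHermitian_diagonal _).sub ?_) fun x => ?_
  · rwa [IsHermitian, conjTranspose_eq_transpose_of_trivial]
  have hquad : x ⬝ᵥ (B *ᵥ x) = ∑ i, ∑ j, B i j * (x j * x i) := by
    simp only [dotProduct, mulVec, Finset.mul_sum]
    exact Finset.sum_congr rfl fun i _ => Finset.sum_congr rfl fun j _ => by ring
  have hdiag : x ⬝ᵥ (diagonal (B * Γ).diag *ᵥ x) = ∑ i, ∑ j, B i j * (x i ^ 2 * Γ j i) := by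
    simp only [dotProduct, mulVec_diagonal, diag_apply, mul_apply, Finset.sum_mul, Finset.mul_sum]
    exact Finset.sum_congr rfl fun i _ => Finset.sum_congr rfl fun j _ => by ring
  have hswap : ∑ i, ∑ j, B i j * (x j ^ 2 * Γ j i) = ∑ i, ∑ j, B i j * (x i ^ 2 * Γ j i) := by
    rw [Finset.sum_comm]
    refine Finset.sum_congr rfl fun i _ => Finset.sum_congr rfl fun j _ => ?_
    rw [hB.apply, (isSymm_of_posSemidef hΓ.posSemidef).apply j i]
  have hfirst := hΓ.sum_mul_le_of_isMaxOn hmax x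
  have hsplit (i j : ι) : B i j * ((x j ^ 2 + x i ^ 2) / 2 * Γ j i) =
      (B i j * (x j ^ 2 * Γ j i) + B i j * (x i ^ 2 * Γ j i)) / 2 := by ring
  simp only [hsplit, ← Finset.sum_div, Finset.sum_add_distrib, hswap] at hfirst
  rw [star_trivial, sub_mulVec, dotProduct_sub, hquad, hdiag]
  linarith

end Correlation

section Bipartite

variable {S T : Type*} [Fintype S] [Fintype T]

/-- The largest value of `∑ s, ∑ t, A s t * ⟪u s, v t⟫` over real unit vectors `u s`, `v t`. For
the signed matrix of an XOR game this is the quantum bias. -/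
noncomputable def maxCorrelation (A : Matrix S T ℝ) : ℝ :=
  sSup ((fun Γ : Matrix (S ⊕ T) (S ⊕ T) ℝ => ∑ s, ∑ t, A s t * Γ (.inl s) (.inr t)) ''
    {Γ | IsCorrelation Γ})

lemma exists_isMaxOn_isCorrelation (A : Matrix S T ℝ) :
    ∃ Γ : Matrix (S ⊕ T) (S ⊕ T) ℝ, IsCorrelation Γ ∧
      IsMaxOn (fun M => (fromBlocks 0 A Aᵀ 0 * M).trace) {M | IsCorrelation M} Γ ∧
      ∑ s, ∑ t, A s t * Γ (.inl s) (.inr t) = maxCorrelation A := by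
  classical
  obtain ⟨Γ, hΓ, hmax⟩ := isCompact_isCorrelation.exists_isMaxOn
    ⟨1, PosSemidef.one, fun _ => one_apply_eq _⟩
    (f := fun M : Matrix (S ⊕ T) (S ⊕ T) ℝ => (fromBlocks 0 A Aᵀ 0 * M).trace) (by fun_prop)
  have htrace {M : Matrix (S ⊕ T) (S ⊕ T) ℝ} (hM : IsCorrelation M) :=
    trace_fromBlocks_offDiag_mul A (isSymm_of_posSemidef hM.posSemidef)
  have hgreatest : IsGreatest ((fun Γ : Matrix (S ⊕ T) (S ⊕ T) ℝ =>
      ∑ s, ∑ t, A s t * Γ (.inl s) (.inr t)) '' {Γ | IsCorrelation Γ})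
      (∑ s, ∑ t, A s t * Γ (.inl s) (.inr t)) := by
    refine ⟨⟨Γ, hΓ, rfl⟩, ?_⟩
    rintro _ ⟨M, hM, rfl⟩
    have hle := hmax hM
    simp only [Set.mem_ofPred_eq, htrace hM, htrace hΓ] at hle
    linarith
  exact ⟨Γ, hΓ, hmax, hgreatest.csSup_eq.symm⟩

theorem exists_dual_maxCorrelation [DecidableEq S] [DecidableEq T] (A : Matrix S T ℝ) :
    ∃ (p : S → ℝ) (q : T → ℝ), (fromBlocks (diagonal p) A Aᵀ (diagonal q)).PosSemidef ∧
      ∑ s, p s = maxCorrelation A ∧ ∑ t, q t = maxCorrelation A := by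
  obtain ⟨Γ, hΓ, hmax, hval⟩ := exists_isMaxOn_isCorrelation A
  have hsymm (s : S) (t : T) : Γ (.inr t) (.inl s) = Γ (.inl s) (.inr t) :=
    (isSymm_of_posSemidef hΓ.posSemidef).apply _ _
  have hdual := hΓ.posSemidef_diagonal_sub_of_isMaxOn (by simp [IsSymm, fromBlocks_transpose]) hmax
  have heq : diagonal (fromBlocks 0 A Aᵀ 0 * Γ).diag - fromBlocks 0 A Aᵀ 0 =
      fromBlocks (diagonal fun s => ∑ t, A s t * Γ (.inl s) (.inr t)) (-A) (-Aᵀ)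
        (diagonal fun t => ∑ s, A s t * Γ (.inl s) (.inr t)) := by
    ext (i | i) (j | j) <;> simp [diagonal_apply, mul_apply, hsymm]
  refine ⟨_, _, ?_, hval, Finset.sum_comm.trans hval⟩
  have hneg := posSemidef_fromBlocks_neg (heq ▸ hdual)
  rwa [neg_neg, neg_neg] at hneg

end Bipartite

/-! ### Parity kernels -/

/-- The sign `(-1) ^ b` of a bit. -/
def boolSign (b : Bool) : ℝ := if b then -1 else 1

@[simp] lemma boolSign_true : boolSign true = -1 := rfl

@[simp] lemma boolSign_false : boolSign false = 1 := rfl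

lemma abs_boolSign (b : Bool) : |boolSign b| = 1 := by cases b <;> simp

lemma ite_xor_eq (a b c : Bool) :
    (if xor a b = c then (1 : ℝ) else 0) = (1 + boolSign a * boolSign b * boolSign c) / 2 := by
  cases a <;> cases b <;> cases c <;> norm_num

section ParityKernel

variable {ι : Type*}

/-- The character `a ↦ (-1) ^ (∑ i ∈ I, a i)` of the group of bit strings. -/
def character (I : Finset ι) (a : ι → Bool) : ℝ := ∏ i ∈ I, boolSign (a i)

lemma abs_character (I : Finset ι) (a : ι → Bool) : |character I a| = 1 := by
  simp [character, Finset.abs_prod, abs_boolSign]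

variable [Fintype ι]

lemma sum_sum_prod [DecidableEq ι] {R : Type*} [CommSemiring R] {α β : ι → Type*}
    [∀ i, Fintype (α i)] [∀ i, Fintype (β i)] (F : ∀ i, α i → β i → R) :
    ∑ a : ∀ i, α i, ∑ b : ∀ i, β i, ∏ i, F i (a i) (b i) = ∏ i, ∑ x, ∑ y, F i x y := by
  simp only [Fintype.prod_sum]

/-- The kernel on bit strings which is the tensor product of the kernels
`u i + (-1) ^ (a + b) * v i` on single bits. -/
def parityKernel (u v : ι → ℝ) : Matrix (ι → Bool) (ι → Bool) ℝ :=
  of fun a b => ∏ i, (u i + boolSign (a i) * boolSign (b i) * v i)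

lemma parityKernel_nonneg {u v : ι → ℝ} (h : ∀ i, |v i| ≤ u i) (a b : ι → Bool) :
    0 ≤ parityKernel u v a b := by
  refine Finset.prod_nonneg fun i _ => ?_
  have habs : |boolSign (a i) * boolSign (b i) * v i| ≤ u i := by
    simpa [abs_mul, abs_boolSign] using h i
  linarith [neg_le_of_abs_le habs]

lemma parityKernel_eq_sum_character [DecidableEq ι] (u v : ι → ℝ) :
    parityKernel u v = ∑ I : Finset ι, ((∏ i ∈ I, v i) * ∏ i ∈ Iᶜ, u i) •
      vecMulVec (character I) (character I) := by
  ext a b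
  simp only [parityKernel, of_apply, add_comm (u _), Fintype.prod_add, Matrix.sum_apply,
    Matrix.smul_apply, vecMulVec_apply, character, Finset.prod_mul_distrib, smul_eq_mul]
  exact Finset.sum_congr rfl fun I _ => by ring

lemma sum_parityKernel_mul_parityKernel [DecidableEq ι] (u v u' v' : ι → ℝ) :
    ∑ a, ∑ b, parityKernel u v a b * parityKernel u' v' a b =
      ∏ i, 4 * (u i * u' i + v i * v' i) := by
  simp only [parityKernel, of_apply, ← Finset.prod_mul_distrib]
  rw [sum_sum_prod fun i (x y : Bool) => (u i + boolSign x * boolSign y * v i) *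
    (u' i + boolSign x * boolSign y * v' i)]
  refine Finset.prod_congr rfl fun i _ => ?_
  simp only [Fintype.sum_bool, boolSign_true, boolSign_false]
  ring

lemma sum_parityKernel [DecidableEq ι] (u v : ι → ℝ) :
    ∑ a, ∑ b, parityKernel u v a b = ∏ i, 4 * u i := by
  simpa [parityKernel] using sum_parityKernel_mul_parityKernel u v 1 0

/-- The quadratic form of `Q` is at most `1` on sign vectors. This is all that the upper bound on
the values of a conjunction needs to know about the answers to a single question. -/
def SignBounded {A : Type*} [Fintype A] (Q : Matrix A A ℝ) : Prop :=
  ∀ c : A → ℝ, (∀ a, |c a| = 1) → c ⬝ᵥ (Q *ᵥ c) ≤ 1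

lemma signBounded_of_sum_abs_le_one {A : Type*} [Fintype A] {Q : Matrix A A ℝ}
    (hQ : ∑ a, ∑ b, |Q a b| ≤ 1) : SignBounded Q := by
  intro c hc
  refine le_trans ?_ hQ
  simp only [dotProduct, mulVec, Finset.mul_sum]
  refine Finset.sum_le_sum fun a _ => Finset.sum_le_sum fun b _ => (le_abs_self _).trans_eq ?_
  simp [abs_mul, hc]

lemma SignBounded.trace_parityKernel_mul_le [DecidableEq ι] {Q : Matrix (ι → Bool) (ι → Bool) ℝ}
    (hQ : SignBounded Q) {u v : ι → ℝ} (hu : ∀ i, 0 ≤ u i) (hv : ∀ i, 0 ≤ v i) :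
    (parityKernel u v * Q).trace ≤ ∏ i, (u i + v i) := by
  simp only [parityKernel_eq_sum_character, Finset.sum_mul, trace_sum, smul_mul, trace_smul,
    smul_eq_mul, add_comm (u _), Fintype.prod_add]
  refine Finset.sum_le_sum fun I _ => mul_le_of_le_one_right
    (mul_nonneg (Finset.prod_nonneg fun i _ => hv i) (Finset.prod_nonneg fun i _ => hu i)) ?_
  rw [vecMulVec_mul, trace_vecMulVec, dotProduct_comm, ← dotProduct_mulVec]
  exact hQ _ (abs_character I)

section ParityMatrix

variable {X Y : ι → Type*}

/-- The matrix which combines, for each pair of questions, even parts `M i` and odd parts `N i` of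
the single games into a parity kernel on the strings of answers. -/
def parityMatrix (M N : ∀ i, Matrix (X i) (Y i) ℝ) :
    Matrix ((∀ i, X i) × (ι → Bool)) ((∀ i, Y i) × (ι → Bool)) ℝ :=
  of fun x y => parityKernel (fun i => M i (x.1 i) (y.1 i)) (fun i => N i (x.1 i) (y.1 i)) x.2 y.2

lemma transpose_parityMatrix (M N : ∀ i, Matrix (X i) (Y i) ℝ) :
    (parityMatrix M N)ᵀ = parityMatrix (fun i => (M i)ᵀ) fun i => (N i)ᵀ := by
  ext x y
  simp [parityMatrix, parityKernel, mul_comm (boolSign (x.2 _))]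

lemma posSemidef_parityMatrix [∀ i, Finite (X i)] {M N : ∀ i, Matrix (X i) (X i) ℝ}
    (hM : ∀ i, (M i).PosSemidef) (hN : ∀ i, (N i).PosSemidef) : (parityMatrix M N).PosSemidef := by
  refine posSemidef_finset_prod Finset.univ fun i _ => ?_
  let question (x : (∀ i, X i) × (ι → Bool)) : X i := x.1 i
  exact ((hM i).submatrix question).add
    (posSemidef_mul_mul_apply ((hN i).submatrix question) fun x => boolSign (x.2 i))

lemma posSemidef_fromBlocks_parityMatrix [∀ i, Finite (X i)] [∀ i, Finite (Y i)]
    {A A' : ∀ i, Matrix (X i) (X i) ℝ} {B B' : ∀ i, Matrix (X i) (Y i) ℝ}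
    {D D' : ∀ i, Matrix (Y i) (Y i) ℝ}
    (h : ∀ i, (fromBlocks (A i) (B i) (B i)ᵀ (D i)).PosSemidef)
    (h' : ∀ i, (fromBlocks (A' i) (B' i) (B' i)ᵀ (D' i)).PosSemidef) :
    (fromBlocks (parityMatrix A A') (parityMatrix B B') (parityMatrix B B')ᵀ
      (parityMatrix D D')).PosSemidef := by
  rw [transpose_parityMatrix]
  convert (posSemidef_parityMatrix h h').submatrix
    (Sum.elim (fun x : (∀ i, X i) × (ι → Bool) => (fun i => .inl (x.1 i), x.2))
      fun y : (∀ i, Y i) × (ι → Bool) => (fun i => .inr (y.1 i), y.2)) using 1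
  ext (x | x) (y | y) <;> rfl

lemma trace_parityMatrix_diagonal_mul_le [DecidableEq ι] [∀ i, Fintype (X i)]
    [∀ i, DecidableEq (X i)] {u v : ∀ i, X i → ℝ} (hu : ∀ i x, 0 ≤ u i x) (hv : ∀ i x, 0 ≤ v i x)
    {Q : Matrix ((∀ i, X i) × (ι → Bool)) ((∀ i, X i) × (ι → Bool)) ℝ}
    (hQ : ∀ x, SignBounded (Q.submatrix (Prod.mk x) (Prod.mk x))) :
    (parityMatrix (fun i => diagonal (u i)) (fun i => diagonal (v i)) * Q).trace ≤
      ∏ i, ∑ x, (u i x + v i x) := by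
  rw [trace_mul_eq_sum_trace_of_blockDiagonal fun x y hxy a b => ?_, Fintype.prod_sum]
  · refine Finset.sum_le_sum fun x _ => ?_
    have hblock : (parityMatrix (fun i => diagonal (u i)) fun i => diagonal (v i)).submatrix
        (Prod.mk x) (Prod.mk x) = parityKernel (fun i => u i (x i)) fun i => v i (x i) := by
      ext
      simp [parityMatrix]
    exact hblock ▸ (hQ x).trace_parityKernel_mul_le (fun i => hu i _) fun i => hv i _
  · obtain ⟨i, hi⟩ := Function.ne_iff.1 hxy
    exact Finset.prod_eq_zero (Finset.mem_univ i) (by simp [diagonal_apply_ne _ hi])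

end ParityMatrix

end ParityKernel

/-! ### Conjunctions of XOR games -/

section DualCertificate

variable {S T : Type*} [DecidableEq S] [DecidableEq T]

lemma posSemidef_fromBlocks_marginals [Fintype S] [Fintype T] {p : Matrix S T ℝ}
    (hp : ∀ s t, 0 ≤ p s t) :
    (fromBlocks (diagonal fun s => ∑ t, p s t) p pᵀ (diagonal fun t => ∑ s, p s t)).PosSemidef := by
  let point (s : S) (t : T) : S ⊕ T → ℝ := Sum.elim (Pi.single s 1) (Pi.single t 1)
  have hsum : fromBlocks (diagonal fun s => ∑ t, p s t) p pᵀ (diagonal fun t => ∑ s, p s t) =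
      ∑ s, ∑ t, p s t • vecMulVec (point s t) (star (point s t)) := by
    ext (i | i) (j | j) <;>
      simp +contextual [point, Matrix.sum_apply, vecMulVec_apply, diagonal_apply, Pi.single_apply]
  rw [hsum]
  exact posSemidef_sum _ fun s _ => posSemidef_sum _ fun t _ =>
    (posSemidef_vecMulVec_self_star _).smul (hp s t)

lemma posSemidef_fromBlocks_diagonal_smul {p : S → ℝ} {q : T → ℝ} {A : Matrix S T ℝ} {c : ℝ}
    (hc : 0 ≤ c) (h : (fromBlocks (diagonal p) A Aᵀ (diagonal q)).PosSemidef) :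
    (fromBlocks (diagonal (c • p)) (c • A) (c • A)ᵀ (diagonal (c • q))).PosSemidef := by
  simpa only [fromBlocks_smul, diagonal_smul, transpose_smul] using h.smul hc

end DualCertificate

namespace XORGame

variable {S T : Type*} [Fintype S] [Fintype T]

/-- The matrix with entries `π(s,t) (-1)^f(s,t)`. -/
def signedMatrix (G : XORGame S T) : Matrix S T ℝ :=
  of fun s t => G.π s t * boolSign (G.f s t)

/-- The quantum bias: twice the quantum value of the XOR game, minus one. -/
noncomputable def bias (G : XORGame S T) : ℝ := maxCorrelation G.signedMatrix

lemma costMatrix_conjunction {n : ℕ} {S T : Fin n → Type*} [∀ i, Fintype (S i)]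
    [∀ i, Fintype (T i)] (G : ∀ i, XORGame (S i) (T i)) :
    (conjunction G).costMatrix = parityMatrix (fun i => (1 / 2 : ℝ) • of (G i).π)
      fun i => (1 / 2 : ℝ) • (G i).signedMatrix := by
  ext ⟨s, a⟩ ⟨t, b⟩
  have hwin : (if ∀ i, xor (a i) (b i) = (G i).f (s i) (t i) then (1 : ℝ) else 0) =
      ∏ i, if xor (a i) (b i) = (G i).f (s i) (t i) then (1 : ℝ) else 0 := by
    rw [Finset.prod_ite_zero]
    simp
  simp only [TwoProverGame.costMatrix, conjunction, parityMatrix, parityKernel, of_apply,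
    decide_eq_true_eq, hwin, ite_xor_eq, ← Finset.prod_mul_distrib, signedMatrix,
    Matrix.smul_apply, smul_eq_mul]
  exact Finset.prod_congr rfl fun i _ => by ring

end XORGame

namespace TwoProverGame

variable {S T A B : Type*} [Fintype S] [Fintype T] [Fintype A] [Fintype B]
  (G : TwoProverGame S T A B) {P : Matrix ((S × A) ⊕ (T × B)) ((S × A) ⊕ (T × B)) ℝ}

lemma objective_eq_sum (hP : P.IsSymm) :
    G.objective P = ∑ x, ∑ y, G.costMatrix x y * P (.inl x) (.inr y) := by
  rw [objective, symCostMatrix, smul_mul, trace_smul, trace_fromBlocks_offDiag_mul _ hP,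
    smul_eq_mul]
  ring

lemma two_mul_objective_le (hP : P.PosSemidef) {U : Matrix (S × A) (S × A) ℝ}
    {V : Matrix (T × B) (T × B) ℝ}
    (hdual : (fromBlocks U G.costMatrix G.costMatrixᵀ V).PosSemidef) :
    2 * G.objective P ≤ (U * P.toBlocks₁₁).trace + (V * P.toBlocks₂₂).trace := by
  have hsplit : fromBlocks U (-G.costMatrix) (-G.costMatrixᵀ) V =
      fromBlocks U 0 0 V - fromBlocks 0 G.costMatrix G.costMatrixᵀ 0 := by
    simp [sub_eq_add_neg, fromBlocks_neg, fromBlocks_add]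
  have hnonneg := trace_mul_nonneg_of_posSemidef (posSemidef_fromBlocks_neg hdual) hP
  rw [hsplit, sub_mul, trace_sub, trace_fromBlocks_diag_mul,
    trace_fromBlocks_offDiag_mul _ (isSymm_of_posSemidef hP),
    ← G.objective_eq_sum (isSymm_of_posSemidef hP)] at hnonneg
  linarith

end TwoProverGame

/-- A common weakening of the two Feige–Lovász relaxations and of being the Gram matrix of a
quantum strategy. -/
structure FeasibleSign {S T A B : Type*} [Fintype A] [Fintype B]
    (P : Matrix ((S × A) ⊕ (T × B)) ((S × A) ⊕ (T × B)) ℝ) : Prop where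
  posSemidef : P.PosSemidef
  signBounded_left : ∀ s, SignBounded (P.toBlocks₁₁.submatrix (Prod.mk s) (Prod.mk s))
  signBounded_right : ∀ t, SignBounded (P.toBlocks₂₂.submatrix (Prod.mk t) (Prod.mk t))

section Feasible

variable {S T A B : Type*} [Fintype A] [Fintype B]
  {P : Matrix ((S × A) ⊕ (T × B)) ((S × A) ⊕ (T × B)) ℝ}

lemma FeasibleSigma.feasibleSigmaBar (hP : FeasibleSigma P) : FeasibleSigmaBar P where
  posSemidef := hP.posSemidef
  nonneg_ST _ _ _ _ := hP.nonneg _ _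
  sum_SS s s' := by simpa only [abs_of_nonneg (hP.nonneg _ _)] using (hP.sum_SS s s').le
  sum_TT t t' := by simpa only [abs_of_nonneg (hP.nonneg _ _)] using (hP.sum_TT t t').le

lemma FeasibleSigmaBar.feasibleSign (hP : FeasibleSigmaBar P) : FeasibleSign P where
  posSemidef := hP.posSemidef
  signBounded_left s := signBounded_of_sum_abs_le_one (hP.sum_SS s s)
  signBounded_right t := signBounded_of_sum_abs_le_one (hP.sum_TT t t)

end Feasible

section CorrelationBlock

variable {ι : Type*} [Fintype ι]

/-- The joint distribution of strings of uniform bits `a`, `b` such that, independently for each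
`i`, the bits `a i` and `b i` have correlation `r i`. -/
noncomputable def correlationBlock {X Y : ι → Type*} (r : ∀ i, Matrix (X i) (Y i) ℝ) :
    Matrix ((∀ i, X i) × (ι → Bool)) ((∀ i, Y i) × (ι → Bool)) ℝ :=
  parityMatrix (fun _ => of fun _ _ => 1 / 4) fun i => (1 / 4 : ℝ) • r i

lemma correlationBlock_nonneg {X Y : ι → Type*} {r : ∀ i, Matrix (X i) (Y i) ℝ}
    (hr : ∀ i x y, |r i x y| ≤ 1) (x : (∀ i, X i) × (ι → Bool)) (y : (∀ i, Y i) × (ι → Bool)) :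
    0 ≤ correlationBlock r x y :=
  parityKernel_nonneg (fun i => by simpa [abs_mul] using hr i (x.1 i) (y.1 i)) _ _

lemma sum_correlationBlock [DecidableEq ι] {X Y : ι → Type*} (r : ∀ i, Matrix (X i) (Y i) ℝ)
    (x : ∀ i, X i) (y : ∀ i, Y i) : ∑ a, ∑ b, correlationBlock r (x, a) (y, b) = 1 := by
  simp only [correlationBlock, parityMatrix, of_apply, sum_parityKernel]
  norm_num

variable {S T : ι → Type*}

/-- The product of the correlation matrices of the single games as a candidate solution of the
relaxations of their conjunction. -/
noncomputable def correlationSolution (Γ : ∀ i, Matrix (S i ⊕ T i) (S i ⊕ T i) ℝ) :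
    Matrix (((∀ i, S i) × (ι → Bool)) ⊕ ((∀ i, T i) × (ι → Bool)))
      (((∀ i, S i) × (ι → Bool)) ⊕ ((∀ i, T i) × (ι → Bool))) ℝ :=
  fromBlocks (correlationBlock fun i => (Γ i).toBlocks₁₁)
    (correlationBlock fun i => (Γ i).toBlocks₁₂)
    (correlationBlock fun i => (Γ i).toBlocks₁₂)ᵀ
    (correlationBlock fun i => (Γ i).toBlocks₂₂)

lemma feasibleSigma_correlationSolution [DecidableEq ι] [∀ i, Finite (S i)] [∀ i, Finite (T i)]
    {Γ : ∀ i, Matrix (S i ⊕ T i) (S i ⊕ T i) ℝ} (hΓ : ∀ i, IsCorrelation (Γ i)) :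
    FeasibleSigma (correlationSolution Γ) where
  posSemidef := by
    refine posSemidef_fromBlocks_parityMatrix (fun i => ?_) fun i => ?_
    · convert posSemidef_vecMulVec_self_star fun _ : S i ⊕ T i => (1 / 2 : ℝ) using 1
      ext (_ | _) (_ | _) <;> simp [vecMulVec_apply] <;> norm_num
    · convert (hΓ i).posSemidef.smul (by norm_num : (0 : ℝ) ≤ 1 / 4) using 1
      ext (x | x) (y | y) <;>
        simp [toBlocks₁₁, toBlocks₁₂, toBlocks₂₂, (isSymm_of_posSemidef (hΓ i).posSemidef).apply]
  nonneg := by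
    rintro (⟨x, a⟩ | ⟨x, a⟩) (⟨y, b⟩ | ⟨y, b⟩) <;>
      exact correlationBlock_nonneg (fun i _ _ => (hΓ i).abs_apply_le_one _ _) _ _
  sum_SS := sum_correlationBlock _
  sum_ST := sum_correlationBlock _
  sum_TS t s := Finset.sum_comm.trans (sum_correlationBlock _ s t)
  sum_TT := sum_correlationBlock _

end CorrelationBlock

namespace XORGame

variable {n : ℕ} {S T : Fin n → Type*} [∀ i, Fintype (S i)] [∀ i, Fintype (T i)]

theorem objective_conjunction_le (G : ∀ i, XORGame (S i) (T i))
    {P : Matrix (((∀ i, S i) × (Fin n → Bool)) ⊕ ((∀ i, T i) × (Fin n → Bool)))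
      (((∀ i, S i) × (Fin n → Bool)) ⊕ ((∀ i, T i) × (Fin n → Bool))) ℝ} (hP : FeasibleSign P) :
    (conjunction G).objective P ≤ ∏ i, (1 + (G i).bias) / 2 := by
  classical
  choose p q hdual hp hq using fun i => exists_dual_maxCorrelation (G i).signedMatrix
  have hp_nonneg (i s) : 0 ≤ p i s := by simpa using (hdual i).diag_nonneg (i := .inl s)
  have hq_nonneg (i t) : 0 ≤ q i t := by simpa using (hdual i).diag_nonneg (i := .inr t)
  have hhalf : (0 : ℝ) ≤ 1 / 2 := by norm_num
  have hcert := posSemidef_fromBlocks_parityMatrix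
    (fun i => posSemidef_fromBlocks_diagonal_smul hhalf
      (posSemidef_fromBlocks_marginals (p := of (G i).π) (G i).π_nonneg))
    (fun i => posSemidef_fromBlocks_diagonal_smul hhalf (hdual i))
  rw [← costMatrix_conjunction] at hcert
  have hleft := trace_parityMatrix_diagonal_mul_le
    (u := fun i => (1 / 2 : ℝ) • fun s => ∑ t, (G i).π s t) (v := fun i => (1 / 2 : ℝ) • p i)
    (fun i s => mul_nonneg hhalf (Finset.sum_nonneg fun t _ => (G i).π_nonneg s t))
    (fun i s => mul_nonneg hhalf (hp_nonneg i s)) hP.signBounded_left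
  have hright := trace_parityMatrix_diagonal_mul_le
    (u := fun i => (1 / 2 : ℝ) • fun t => ∑ s, (G i).π s t) (v := fun i => (1 / 2 : ℝ) • q i)
    (fun i t => mul_nonneg hhalf (Finset.sum_nonneg fun s _ => (G i).π_nonneg s t))
    (fun i t => mul_nonneg hhalf (hq_nonneg i t)) hP.signBounded_right
  have hvalue (i) :
      (1 + (G i).bias) / 2 = 1 / 2 * 1 + 1 / 2 * maxCorrelation (G i).signedMatrix := by
    rw [bias]
    ring
  have hsum (i) : ∑ t, ∑ s, (G i).π s t = 1 := Finset.sum_comm.trans (G i).π_sum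
  simp only [Pi.smul_apply, smul_eq_mul, Finset.sum_add_distrib, ← Finset.mul_sum, (G _).π_sum,
    hsum, hp, hq, ← hvalue] at hleft hright
  have hweak := (conjunction G).two_mul_objective_le hP.posSemidef hcert
  simp only [of_apply] at hweak
  linarith

lemma sum_costMatrix_mul_correlationBlock (G : ∀ i, XORGame (S i) (T i))
    (r : ∀ i, Matrix (S i) (T i) ℝ) :
    ∑ x, ∑ y, (conjunction G).costMatrix x y * correlationBlock r x y =
      ∏ i, (1 + ∑ s, ∑ t, (G i).signedMatrix s t * r i s t) / 2 := by
  have hquestion (s : ∀ i, S i) (t : ∀ i, T i) :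
      ∑ a, ∑ b, (conjunction G).costMatrix (s, a) (t, b) * correlationBlock r (s, a) (t, b) =
        ∏ i, ((G i).π (s i) (t i) + (G i).signedMatrix (s i) (t i) * r i (s i) (t i)) / 2 := by
    simp only [costMatrix_conjunction, correlationBlock, parityMatrix, of_apply,
      sum_parityKernel_mul_parityKernel, Matrix.smul_apply, smul_eq_mul]
    exact Finset.prod_congr rfl fun i _ => by ring
  calc
    _ = ∑ s : ∀ i, S i, ∑ t : ∀ i, T i, ∑ a, ∑ b,
        (conjunction G).costMatrix (s, a) (t, b) * correlationBlock r (s, a) (t, b) := by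
      simp only [Fintype.sum_prod_type]
      exact Finset.sum_congr rfl fun s _ => Finset.sum_comm
    _ = ∏ i, (1 + ∑ s, ∑ t, (G i).signedMatrix s t * r i s t) / 2 := by
      simp only [hquestion]
      rw [sum_sum_prod fun i s t => ((G i).π s t + (G i).signedMatrix s t * r i s t) / 2]
      simp only [← Finset.sum_div, Finset.sum_add_distrib, (G _).π_sum]

end XORGame

/-! ### Tensor products -/

section TensorProduct

variable {ι : Type*} [Fintype ι] {K L : ι → Type*} {R 𝕜 : Type*} [CommSemiring R] [RCLike 𝕜]

/-- The tensor product of the matrices `M i`, in the product basis. -/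
def tensorMatrix (M : ∀ i, Matrix (K i) (K i) R) : Matrix (∀ i, K i) (∀ i, K i) R :=
  of fun x y => ∏ i, M i (x i) (y i)

/-- The tensor product of the bipartite states `ψ i`, with all first and all second systems
grouped together. -/
def tensorState (ψ : ∀ i, K i × L i → R) : (∀ i, K i) × (∀ i, L i) → R :=
  fun x => ∏ i, ψ i (x.1 i, x.2 i)

lemma tensorMatrix_smul (c : ι → R) (M : ∀ i, Matrix (K i) (K i) R) :
    tensorMatrix (fun i => c i • M i) = (∏ i, c i) • tensorMatrix M := by
  ext
  simp only [tensorMatrix, of_apply, Matrix.smul_apply, smul_eq_mul, Finset.prod_mul_distrib]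

lemma tensorMatrix_one [∀ i, DecidableEq (K i)] :
    tensorMatrix (fun i => (1 : Matrix (K i) (K i) R)) = 1 := by
  ext
  simp only [tensorMatrix, of_apply, one_apply, Finset.prod_ite_zero, funext_iff, Finset.mem_univ,
    forall_const, Finset.prod_const_one]

lemma conjTranspose_tensorMatrix [StarRing R] (M : ∀ i, Matrix (K i) (K i) R) :
    (tensorMatrix M)ᴴ = tensorMatrix fun i => (M i)ᴴ := by
  ext
  simp only [tensorMatrix, conjTranspose_apply, of_apply, star_prod]

lemma sum_tensorMatrix [DecidableEq ι] {A : ι → Type*} [∀ i, Fintype (A i)]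
    (M : ∀ i, A i → Matrix (K i) (K i) R) :
    ∑ a : ∀ i, A i, tensorMatrix (fun i => M i (a i)) = tensorMatrix fun i => ∑ a, M i a := by
  ext
  simp only [tensorMatrix, of_apply, Matrix.sum_apply, Fintype.prod_sum]

lemma posSemidef_tensorMatrix [∀ i, Finite (K i)] {M : ∀ i, Matrix (K i) (K i) 𝕜}
    (hM : ∀ i, (M i).PosSemidef) : (tensorMatrix M).PosSemidef :=
  posSemidef_finset_prod Finset.univ
    (M := fun i => (M i).submatrix (fun x : ∀ i, K i => x i) fun x => x i)
    fun i _ => (hM i).submatrix _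

variable [DecidableEq ι] [∀ i, Fintype (K i)] [∀ i, Fintype (L i)]

lemma tensorMatrix_mul (M N : ∀ i, Matrix (K i) (K i) R) :
    tensorMatrix M * tensorMatrix N = tensorMatrix fun i => M i * N i := by
  ext
  simp only [tensorMatrix, mul_apply, of_apply, Fintype.prod_sum, Finset.prod_mul_distrib]

lemma trace_tensorMatrix (M : ∀ i, Matrix (K i) (K i) R) :
    (tensorMatrix M).trace = ∏ i, (M i).trace := by
  simp only [trace, tensorMatrix, diag_apply, of_apply, Fintype.prod_sum]

lemma star_tensorState_dotProduct [StarRing R] (φ ψ : ∀ i, K i × L i → R) :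
    star (tensorState φ) ⬝ᵥ tensorState ψ = ∏ i, star (φ i) ⬝ᵥ ψ i := by
  simp only [dotProduct, Fintype.sum_prod_type, tensorState, Pi.star_apply, star_prod,
    ← Finset.prod_mul_distrib]
  exact sum_sum_prod fun i x y => star (φ i (x, y)) * ψ i (x, y)

lemma tensorMatrix_kronecker_mulVec_tensorState (M : ∀ i, Matrix (K i) (K i) R)
    (N : ∀ i, Matrix (L i) (L i) R) (ψ : ∀ i, K i × L i → R) :
    (tensorMatrix M ⊗ₖ tensorMatrix N) *ᵥ tensorState ψ =
      tensorState fun i => (M i ⊗ₖ N i) *ᵥ ψ i := by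
  ext ⟨x, y⟩
  simp only [mulVec, dotProduct, Fintype.sum_prod_type, tensorState, tensorMatrix,
    kroneckerMap_apply, of_apply, ← Finset.prod_mul_distrib]
  exact sum_sum_prod fun i x' y' => M i (x i) x' * N i (y i) y' * ψ i (x', y')

end TensorProduct

/-! ### Quantum strategies -/

/-- A positive operator-valued measure: a measurement with outcomes in `A`. -/
structure IsPOVM {A κ : Type*} [Fintype A] [Fintype κ] [DecidableEq κ]
    (E : A → Matrix κ κ ℂ) : Prop where
  posSemidef : ∀ a, (E a).PosSemidef
  sum_eq_one : ∑ a, E a = 1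

namespace IsPOVM

variable {A κ μ : Type*} [Fintype A] [Fintype κ] [DecidableEq κ] [Fintype μ] [DecidableEq μ]
  {E : A → Matrix κ κ ℂ}

lemma kronecker_one (hE : IsPOVM E) : IsPOVM fun a => E a ⊗ₖ (1 : Matrix μ μ ℂ) where
  posSemidef a := (hE.posSemidef a).kronecker PosSemidef.one
  sum_eq_one := by
    rw [← one_kronecker_one, ← hE.sum_eq_one]
    ext
    simp only [Matrix.sum_apply, kroneckerMap_apply, Finset.sum_mul]

lemma submatrix_equiv (hE : IsPOVM E) (e : μ ≃ κ) : IsPOVM fun a => (E a).submatrix e e where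
  posSemidef a := (hE.posSemidef a).submatrix e
  sum_eq_one := by
    rw [← submatrix_one_equiv e, ← hE.sum_eq_one]
    ext
    simp only [Matrix.sum_apply, submatrix_apply]

lemma one_kronecker (hE : IsPOVM E) : IsPOVM fun a => (1 : Matrix μ μ ℂ) ⊗ₖ E a where
  posSemidef a := PosSemidef.one.kronecker (hE.posSemidef a)
  sum_eq_one := by
    rw [← one_kronecker_one, ← hE.sum_eq_one]
    ext
    simp only [Matrix.sum_apply, kroneckerMap_apply, Finset.mul_sum]

lemma transpose (hE : IsPOVM E) : IsPOVM fun a => (E a)ᵀ where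
  posSemidef a := (hE.posSemidef a).transpose
  sum_eq_one := by rw [← transpose_sum, hE.sum_eq_one, transpose_one]

lemma tensorMatrix {ι : Type*} [Fintype ι] [DecidableEq ι] {A K : ι → Type*}
    [∀ i, Fintype (A i)] [∀ i, Fintype (K i)] [∀ i, DecidableEq (K i)]
    {E : ∀ i, A i → Matrix (K i) (K i) ℂ} (hE : ∀ i, IsPOVM (E i)) :
    IsPOVM fun a : ∀ i, A i => _root_.tensorMatrix fun i => E i (a i) where
  posSemidef a := posSemidef_tensorMatrix fun i => (hE i).posSemidef (a i)
  sum_eq_one := by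
    simp only [sum_tensorMatrix, (hE _).sum_eq_one, tensorMatrix_one]

/-- The variance of the random variable `c` under a measurement is nonnegative. -/
lemma posSemidef_sum_sq_smul_sub (hE : IsPOVM E) (c : A → ℝ) :
    (∑ a, ((c a : ℂ) ^ 2) • E a -
      (∑ a, (c a : ℂ) • E a) * ∑ a, (c a : ℂ) • E a).PosSemidef := by
  set H : Matrix κ κ ℂ := ∑ a, (c a : ℂ) • E a with hH
  have hH_conj : Hᴴ = H := by simp [hH, conjTranspose_sum, (hE.posSemidef _).isHermitian.eq]
  have hexpand (a : A) : ((c a : ℂ) • 1 - H)ᴴ * E a * ((c a : ℂ) • 1 - H) =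
      ((c a : ℂ) ^ 2) • E a - ((c a : ℂ) • E a) * H - H * ((c a : ℂ) • E a) + H * E a * H := by
    simp only [conjTranspose_sub, conjTranspose_smul, conjTranspose_one, hH_conj, sub_mul, mul_sub,
      smul_mul_assoc, mul_smul_comm, one_mul, mul_one, smul_smul, ← pow_two, Complex.star_def,
      Complex.conj_ofReal, smul_sub]
    abel
  have hsum : ∑ a, ((c a : ℂ) ^ 2) • E a - H * H =
      ∑ a, ((c a : ℂ) • 1 - H)ᴴ * E a * ((c a : ℂ) • 1 - H) := by
    simp only [hexpand, Finset.sum_add_distrib, Finset.sum_sub_distrib, ← Finset.sum_mul,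
      ← Finset.mul_sum, hE.sum_eq_one, ← hH, mul_one]
    abel
  rw [hsum]
  exact posSemidef_sum _ fun a _ => (hE.posSemidef a).conjTranspose_mul_mul_same _

lemma signBounded_gram (hE : IsPOVM E) {ψ : κ → ℂ} (hψ : star ψ ⬝ᵥ ψ = 1) :
    SignBounded (of fun a a' => (star (E a *ᵥ ψ) ⬝ᵥ (E a' *ᵥ ψ)).re) := by
  intro c hc
  set H : Matrix κ κ ℂ := ∑ a, (c a : ℂ) • E a with hH
  have hH_conj : Hᴴ = H := by simp [hH, conjTranspose_sum, (hE.posSemidef _).isHermitian.eq]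
  have hsq (a) : (c a : ℂ) ^ 2 = 1 := by
    rw [← Complex.ofReal_pow, ← sq_abs, hc, one_pow, Complex.ofReal_one]
  have hcontraction : (star (H *ᵥ ψ) ⬝ᵥ (H *ᵥ ψ)).re ≤ 1 := by
    have hvar := (hE.posSemidef_sum_sq_smul_sub c).dotProduct_mulVec_nonneg ψ
    simp only [hsq, one_smul, hE.sum_eq_one, ← hH, sub_mulVec, one_mulVec, dotProduct_sub, hψ,
      ← mulVec_mulVec] at hvar
    rw [star_mulVec, hH_conj, ← dotProduct_mulVec]
    simpa using (Complex.le_def.1 hvar).1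
  have hform : c ⬝ᵥ ((of fun a a' => (star (E a *ᵥ ψ) ⬝ᵥ (E a' *ᵥ ψ)).re) *ᵥ c) =
      (star (H *ᵥ ψ) ⬝ᵥ (H *ᵥ ψ)).re := by
    simp only [hH, sum_mulVec, smul_mulVec, star_sum, star_smul, sum_dotProduct, dotProduct_sum,
      smul_dotProduct, dotProduct_smul, smul_eq_mul, Complex.star_def, Complex.conj_ofReal,
      Complex.re_sum, Complex.re_ofReal_mul, Finset.mul_sum]
    simp only [dotProduct, mulVec, of_apply, Finset.mul_sum]
    rw [Finset.sum_comm]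
    exact Finset.sum_congr rfl fun a _ => Finset.sum_congr rfl fun a' _ => by ring
  exact hform.trans_le hcontraction

end IsPOVM

namespace QuantumStrategy

variable {S T A B : Type*} [Fintype A] [Fintype B] (Q : QuantumStrategy S T A B)

lemma isPOVM_M (s : S) : IsPOVM (Q.M s) := ⟨Q.M_pos s, Q.M_sum s⟩

lemma isPOVM_N (t : T) : IsPOVM (Q.N t) := ⟨Q.N_pos t, Q.N_sum t⟩

/-- The measurement operators of both provers, acting on the joint system. -/
noncomputable def jointOperator :
    (S × A) ⊕ (T × B) → Matrix (Fin Q.dA × Fin Q.dB) (Fin Q.dA × Fin Q.dB) ℂ :=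
  Sum.elim (fun x => Q.M x.1 x.2 ⊗ₖ 1) fun y => 1 ⊗ₖ Q.N y.1 y.2

/-- The real part of the Gram matrix of the vectors obtained by applying the measurement
operators to the shared state; it relates quantum strategies to the Feige–Lovász relaxations. -/
noncomputable def gramMatrix : Matrix ((S × A) ⊕ (T × B)) ((S × A) ⊕ (T × B)) ℝ :=
  of fun x y => (star (Q.jointOperator x *ᵥ Q.ψ) ⬝ᵥ (Q.jointOperator y *ᵥ Q.ψ)).re

lemma gramMatrix_inl_inr (s : S) (t : T) (a : A) (b : B) :
    Q.gramMatrix (.inl (s, a)) (.inr (t, b)) = Q.prob s t a b := by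
  simp only [gramMatrix, prob, jointOperator, of_apply, Sum.elim_inl, Sum.elim_inr]
  rw [star_mulVec, ← dotProduct_mulVec, mulVec_mulVec, conjTranspose_kronecker,
    (Q.M_pos s a).isHermitian.eq, conjTranspose_one, ← mul_kronecker_mul, one_mul, mul_one]

lemma feasibleSign_gramMatrix [Finite S] [Finite T] : FeasibleSign Q.gramMatrix where
  posSemidef := posSemidef_re_dotProduct fun x => Q.jointOperator x *ᵥ Q.ψ
  signBounded_left s := (Q.isPOVM_M s).kronecker_one.signBounded_gram Q.ψ_unit
  signBounded_right t := (Q.isPOVM_N t).one_kronecker.signBounded_gram Q.ψ_unit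

end QuantumStrategy

namespace TwoProverGame

variable {S T A B : Type*} [Fintype S] [Fintype T] [Fintype A] [Fintype B]
  (G : TwoProverGame S T A B) (Q : QuantumStrategy S T A B)

lemma successProb_eq_sum :
    G.successProb Q = ∑ x, ∑ y, G.costMatrix x y * Q.prob x.1 y.1 x.2 y.2 := by
  simp only [successProb, costMatrix, of_apply, Finset.mul_sum, mul_ite, mul_one, mul_zero,
    ite_mul, zero_mul, Fintype.sum_prod_type]
  exact Finset.sum_congr rfl fun s _ => Finset.sum_comm

lemma successProb_eq_objective : G.successProb Q = G.objective Q.gramMatrix := by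
  rw [G.objective_eq_sum (isSymm_of_posSemidef Q.feasibleSign_gramMatrix.posSemidef),
    G.successProb_eq_sum]
  simp only [← Q.gramMatrix_inl_inr]

end TwoProverGame

section Clifford

lemma exists_dotProduct_of_posSemidef {ι : Type*} [Finite ι] {Γ : Matrix ι ι ℝ}
    (hΓ : Γ.PosSemidef) : ∃ (m : ℕ) (v : ι → Fin m → ℝ), ∀ i j, Γ i j = v i ⬝ᵥ v j := by
  obtain ⟨m, w, rfl⟩ := posSemidef_iff_eq_sum_vecMulVec.1 hΓ
  exact ⟨m, fun i k => w k i, fun i j => by simp [Matrix.sum_apply, vecMulVec_apply, dotProduct]⟩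

/-- The Pauli matrix `σ_x`. -/
def pauliX : Matrix (Fin 2) (Fin 2) ℂ := !![0, 1; 1, 0]

/-- The Pauli matrix `σ_z`. -/
def pauliZ : Matrix (Fin 2) (Fin 2) ℂ := !![1, 0; 0, -1]

lemma conjTranspose_pauliX : pauliXᴴ = pauliX := by
  ext i j
  fin_cases i <;> fin_cases j <;> simp [pauliX]

lemma conjTranspose_pauliZ : pauliZᴴ = pauliZ := by
  ext i j
  fin_cases i <;> fin_cases j <;> simp [pauliZ]

lemma pauliX_mul_self : pauliX * pauliX = 1 := by simp [pauliX, one_fin_two]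

lemma pauliZ_mul_self : pauliZ * pauliZ = 1 := by simp [pauliZ, one_fin_two]

lemma pauliX_mul_pauliZ : pauliX * pauliZ = -(pauliZ * pauliX) := by simp [pauliX, pauliZ]

variable {ι : Type*} [Fintype ι] [LinearOrder ι]

/-- The Jordan–Wigner representation `σ_z ⊗ ⋯ ⊗ σ_z ⊗ σ_x ⊗ 1 ⊗ ⋯ ⊗ 1` of the generators of the
Clifford algebra, where `σ_x` acts on the `k`-th qubit. -/
noncomputable def cliffordGenerator (k : ι) : Matrix (ι → Fin 2) (ι → Fin 2) ℂ :=
  tensorMatrix fun i => if i < k then pauliZ else if i = k then pauliX else 1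

lemma conjTranspose_cliffordGenerator (k : ι) :
    (cliffordGenerator k)ᴴ = cliffordGenerator k := by
  simp only [cliffordGenerator, conjTranspose_tensorMatrix, apply_ite conjTranspose,
    conjTranspose_pauliX, conjTranspose_pauliZ, conjTranspose_one]

lemma trace_cliffordGenerator (k : ι) : (cliffordGenerator k).trace = 0 := by
  rw [cliffordGenerator, trace_tensorMatrix]
  exact Finset.prod_eq_zero (Finset.mem_univ k) (by simp [pauliX, trace_fin_two])

lemma cliffordGenerator_mul_self (k : ι) : cliffordGenerator k * cliffordGenerator k = 1 := by
  rw [cliffordGenerator, tensorMatrix_mul, ← tensorMatrix_one]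
  congr 1 with i : 1
  split_ifs
  exacts [pauliZ_mul_self, pauliX_mul_self, one_mul 1]

lemma cliffordGenerator_mul_of_lt {k l : ι} (hkl : k < l) :
    cliffordGenerator k * cliffordGenerator l = -(cliffordGenerator l * cliffordGenerator k) := by
  have hfactor (i : ι) :
      (if i < k then pauliZ else if i = k then pauliX else 1) *
          (if i < l then pauliZ else if i = l then pauliX else 1) =
        (if i = k then -1 else 1 : ℂ) •
          ((if i < l then pauliZ else if i = l then pauliX else 1) *
            (if i < k then pauliZ else if i = k then pauliX else 1)) := by
    rcases lt_trichotomy i k with hik | rfl | hki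
    · simp [hik, hik.trans hkl, hik.ne]
    · simp [hkl, pauliX_mul_pauliZ]
    · simp [hki.not_gt, hki.ne']
  simp only [cliffordGenerator, tensorMatrix_mul, hfactor, tensorMatrix_smul,
    Finset.prod_ite_eq', Finset.mem_univ, if_true, neg_one_smul]

lemma cliffordGenerator_anticommutator (k l : ι) :
    cliffordGenerator k * cliffordGenerator l + cliffordGenerator l * cliffordGenerator k =
      (if k = l then 2 else 0 : ℂ) • 1 := by
  rcases lt_trichotomy k l with h | rfl | h
  · rw [cliffordGenerator_mul_of_lt h, neg_add_cancel, if_neg h.ne, zero_smul]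
  · rw [cliffordGenerator_mul_self, if_pos rfl, two_smul]
  · rw [cliffordGenerator_mul_of_lt h, add_neg_cancel, if_neg h.ne', zero_smul]

/-- Tsirelson's observable for the vector `v`: the image of `v` in the Clifford algebra. -/
noncomputable def cliffordVector (v : ι → ℝ) : Matrix (ι → Fin 2) (ι → Fin 2) ℂ :=
  ∑ k, (v k : ℂ) • cliffordGenerator k

lemma conjTranspose_cliffordVector (v : ι → ℝ) : (cliffordVector v)ᴴ = cliffordVector v := by
  simp [cliffordVector, conjTranspose_sum, conjTranspose_cliffordGenerator]

lemma trace_cliffordVector (v : ι → ℝ) : (cliffordVector v).trace = 0 := by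
  simp [cliffordVector, trace_sum, trace_cliffordGenerator]

lemma cliffordVector_anticommutator (v w : ι → ℝ) :
    cliffordVector v * cliffordVector w + cliffordVector w * cliffordVector v =
      (2 * (v ⬝ᵥ w : ℝ) : ℂ) • 1 := by
  have hexpand (x y : ι → ℝ) : cliffordVector x * cliffordVector y =
      ∑ k, ∑ l, (x k * y l : ℂ) • (cliffordGenerator k * cliffordGenerator l) := by
    simp only [cliffordVector, Finset.sum_mul_sum, smul_mul_smul_comm]
  rw [hexpand w v, Finset.sum_comm, hexpand v w]
  simp only [← Finset.sum_add_distrib, mul_comm (w _ : ℂ), ← smul_add,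
    cliffordGenerator_anticommutator, ite_smul, zero_smul, smul_ite, smul_zero, smul_smul,
    Finset.sum_ite_eq, Finset.mem_univ, if_true, ← Finset.sum_smul, ← Finset.sum_mul, dotProduct,
    Complex.ofReal_sum, Complex.ofReal_mul, mul_comm (2 : ℂ)]

lemma cliffordVector_mul_self {v : ι → ℝ} (hv : v ⬝ᵥ v = 1) :
    cliffordVector v * cliffordVector v = 1 := by
  have h := cliffordVector_anticommutator v v
  rw [hv, ← two_smul ℂ] at h
  simpa using h

lemma trace_cliffordVector_mul (v w : ι → ℝ) :
    (cliffordVector v * cliffordVector w).trace =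
      Fintype.card (ι → Fin 2) * ((v ⬝ᵥ w : ℝ) : ℂ) := by
  have h := congrArg trace (cliffordVector_anticommutator v w)
  rw [trace_add, trace_mul_comm (cliffordVector w), trace_smul, trace_one,
    smul_eq_mul] at h
  linear_combination h / 2

end Clifford

section Tsirelson

variable {κ : Type*} [DecidableEq κ]

/-- The projection onto the eigenspace with eigenvalue `boolSign a` of an involution. -/
noncomputable def signProjection (X : Matrix κ κ ℂ) (a : Bool) : Matrix κ κ ℂ :=
  (1 / 2 : ℂ) • (1 + (boolSign a : ℂ) • X)

variable [Fintype κ]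

lemma isPOVM_signProjection {X : Matrix κ κ ℂ} (hX : Xᴴ = X) (hXX : X * X = 1) :
    IsPOVM (signProjection X) where
  posSemidef a := by
    have hproj : signProjection X a = (signProjection X a)ᴴ * signProjection X a := by
      have hconj : (signProjection X a)ᴴ = signProjection X a := by simp [signProjection, hX]
      rw [hconj]
      simp only [signProjection, add_mul, mul_add, one_mul, mul_one, smul_mul_assoc,
        mul_smul_comm, smul_smul, hXX, smul_add]
      cases a <;> simp only [boolSign_true, boolSign_false] <;> push_cast <;> module
    rw [hproj]
    exact posSemidef_conjTranspose_mul_self _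
  sum_eq_one := by
    simp only [signProjection, Fintype.sum_bool, boolSign_true, boolSign_false]
    push_cast
    module

/-- The maximally entangled state `|κ|^{-1/2} ∑ₓ |x⟩ ⊗ |x⟩`. -/
noncomputable def maxEntangled (κ : Type*) [Fintype κ] [DecidableEq κ] : κ × κ → ℂ :=
  fun x => if x.1 = x.2 then ((√(Fintype.card κ : ℝ))⁻¹ : ℝ) else 0

lemma maxEntangled_kronecker_transpose (M N : Matrix κ κ ℂ) :
    star (maxEntangled κ) ⬝ᵥ ((M ⊗ₖ Nᵀ) *ᵥ maxEntangled κ) =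
      (Fintype.card κ : ℂ)⁻¹ * (M * N).trace := by
  have hnorm : (((√(Fintype.card κ : ℝ))⁻¹ : ℝ) : ℂ) * ((√(Fintype.card κ : ℝ))⁻¹ : ℝ) =
      (Fintype.card κ : ℂ)⁻¹ := by
    rw [← Complex.ofReal_mul, ← mul_inv, Real.mul_self_sqrt (Nat.cast_nonneg _),
      Complex.ofReal_inv, Complex.ofReal_natCast]
  simp only [dotProduct, mulVec, Pi.star_apply, Fintype.sum_prod_type, maxEntangled,
    kroneckerMap_apply, transpose_apply, apply_ite star, star_zero, Complex.star_def,
    Complex.conj_ofReal, ite_mul, zero_mul, mul_ite, mul_zero, Finset.sum_ite_eq, Finset.mem_univ,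
    if_true, trace, diag_apply, mul_apply, ← hnorm]
  simp only [Finset.mul_sum]
  exact Finset.sum_congr rfl fun x _ => Finset.sum_congr rfl fun y _ => by ring

variable [Nonempty κ]

lemma star_maxEntangled_dotProduct_self : star (maxEntangled κ) ⬝ᵥ maxEntangled κ = 1 := by
  have h := maxEntangled_kronecker_transpose (1 : Matrix κ κ ℂ) 1
  rw [transpose_one, one_kronecker_one, one_mulVec, mul_one, trace_one] at h
  rw [h, inv_mul_cancel₀ (Nat.cast_ne_zero.2 Fintype.card_ne_zero)]

lemma maxEntangled_signProjection {X Y : Matrix κ κ ℂ} {r : ℝ} (hX : X.trace = 0)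
    (hY : Y.trace = 0) (hXY : (X * Y).trace = Fintype.card κ * r) (a b : Bool) :
    star (maxEntangled κ) ⬝ᵥ
      ((signProjection X a ⊗ₖ (signProjection Y b)ᵀ) *ᵥ maxEntangled κ) =
      ((1 / 4 * (1 + boolSign a * boolSign b * r) : ℝ) : ℂ) := by
  have hcard : (Fintype.card κ : ℂ) ≠ 0 := Nat.cast_ne_zero.2 Fintype.card_ne_zero
  rw [maxEntangled_kronecker_transpose]
  simp only [signProjection, smul_mul_assoc, mul_smul_comm, add_mul, mul_add, one_mul, mul_one,
    trace_smul, trace_add, trace_one, hX, hY, hXY, smul_eq_mul]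
  push_cast
  field_simp
  ring

end Tsirelson

lemma star_dotProduct_reindex_mulVec {K K' L L' : Type*} [Fintype K] [Fintype K'] [Fintype L]
    [Fintype L'] (e : K' ≃ K) (f : L' ≃ L) (ψ : K × L → ℂ) (M : Matrix K K ℂ) (N : Matrix L L ℂ) :
    star (ψ ∘ e.prodCongr f) ⬝ᵥ
        ((M.submatrix e e ⊗ₖ N.submatrix f f) *ᵥ (ψ ∘ e.prodCongr f)) =
      star ψ ⬝ᵥ ((M ⊗ₖ N) *ᵥ ψ) := by
  have hkronecker : M.submatrix e e ⊗ₖ N.submatrix f f =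
      (M ⊗ₖ N).submatrix (e.prodCongr f) (e.prodCongr f) := rfl
  rw [hkronecker, submatrix_mulVec_equiv, Function.comp_assoc, Equiv.self_comp_symm,
    Function.comp_id]
  exact comp_equiv_dotProduct_comp_equiv (star ψ) ((M ⊗ₖ N) *ᵥ ψ) (e.prodCongr f)

namespace QuantumStrategy

section OfPOVM

variable {S T A B K L : Type*} [Fintype A] [Fintype B] [Fintype K] [DecidableEq K] [Fintype L]
  [DecidableEq L] {ψ : K × L → ℂ} {M : S → A → Matrix K K ℂ} {N : T → B → Matrix L L ℂ}

/-- A quantum strategy given on spaces with arbitrary finite bases, transported to coordinates. -/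
noncomputable def ofPOVM (hψ : star ψ ⬝ᵥ ψ = 1) (hM : ∀ s, IsPOVM (M s)) (hN : ∀ t, IsPOVM (N t)) :
    QuantumStrategy S T A B :=
  let e := (Fintype.equivFin K).symm
  let f := (Fintype.equivFin L).symm
  { dA := Fintype.card K
    dB := Fintype.card L
    ψ := ψ ∘ e.prodCongr f
    ψ_unit := (comp_equiv_dotProduct_comp_equiv (star ψ) ψ (e.prodCongr f)).trans hψ
    M := fun s a => (M s a).submatrix e e
    M_pos := fun s => ((hM s).submatrix_equiv e).posSemidef
    M_sum := fun s => ((hM s).submatrix_equiv e).sum_eq_one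
    N := fun t b => (N t b).submatrix f f
    N_pos := fun t => ((hN t).submatrix_equiv f).posSemidef
    N_sum := fun t => ((hN t).submatrix_equiv f).sum_eq_one }

lemma prob_ofPOVM (hψ : star ψ ⬝ᵥ ψ = 1) (hM : ∀ s, IsPOVM (M s)) (hN : ∀ t, IsPOVM (N t))
    (s : S) (t : T) (a : A) (b : B) :
    (ofPOVM hψ hM hN).prob s t a b = (star ψ ⬝ᵥ ((M s a ⊗ₖ N t b) *ᵥ ψ)).re :=
  congrArg Complex.re (star_dotProduct_reindex_mulVec _ _ ψ (M s a) (N t b))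

end OfPOVM

variable {ι : Type*} [Fintype ι] [DecidableEq ι] {S T : ι → Type*}

/-- Tsirelson's strategies, played independently in parallel. -/
theorem exists_prob_eq_correlationBlock {m : ι → ℕ} {u : ∀ i, S i → Fin (m i) → ℝ}
    {v : ∀ i, T i → Fin (m i) → ℝ} (hu : ∀ i s, u i s ⬝ᵥ u i s = 1)
    (hv : ∀ i t, v i t ⬝ᵥ v i t = 1) :
    ∃ Q : QuantumStrategy (∀ i, S i) (∀ i, T i) (ι → Bool) (ι → Bool), ∀ s t a b,
      Q.prob s t a b = correlationBlock (fun i => of fun s t => u i s ⬝ᵥ v i t) (s, a) (t, b) := by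
  have hstate : star (tensorState fun i => maxEntangled (Fin (m i) → Fin 2)) ⬝ᵥ
      (tensorState fun i => maxEntangled (Fin (m i) → Fin 2)) = 1 := by
    rw [star_tensorState_dotProduct]
    exact Finset.prod_eq_one fun i _ => star_maxEntangled_dotProduct_self
  have hmeasure {k : ℕ} {w : Fin k → ℝ} (hw : w ⬝ᵥ w = 1) :
      IsPOVM (signProjection (cliffordVector w)) :=
    isPOVM_signProjection (conjTranspose_cliffordVector w) (cliffordVector_mul_self hw)
  refine ⟨ofPOVM hstate (fun s => IsPOVM.tensorMatrix fun i => hmeasure (hu i (s i)))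
    (fun t => IsPOVM.tensorMatrix fun i => (hmeasure (hv i (t i))).transpose), fun s t a b => ?_⟩
  rw [prob_ofPOVM, tensorMatrix_kronecker_mulVec_tensorState, star_tensorState_dotProduct]
  simp only [maxEntangled_signProjection (trace_cliffordVector _) (trace_cliffordVector _)
    (trace_cliffordVector_mul _ _), ← Complex.ofReal_prod, Complex.ofReal_re]
  simp only [correlationBlock, parityMatrix, parityKernel, of_apply, Matrix.smul_apply, smul_eq_mul]
  exact Finset.prod_congr rfl fun i _ => by ring

end QuantumStrategy

namespace XORGame

variable {n : ℕ} {S T : Fin n → Type*} [∀ i, Fintype (S i)] [∀ i, Fintype (T i)]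
  (G : ∀ i, XORGame (S i) (T i))

theorem isGreatest_successProb_conjunction :
    IsGreatest (Set.range (conjunction G).successProb) (∏ i, (1 + (G i).bias) / 2) := by
  choose Γ hΓ _ hvalue using fun i => exists_isMaxOn_isCorrelation (G i).signedMatrix
  choose m v hv using fun i => exists_dotProduct_of_posSemidef (hΓ i).posSemidef
  have hunit (i x) : v i x ⬝ᵥ v i x = 1 := (hv i x x).symm.trans ((hΓ i).diag_eq_one x)
  constructor
  · obtain ⟨Q, hQ⟩ := QuantumStrategy.exists_prob_eq_correlationBlock
      (fun i s => hunit i (.inl s)) fun i t => hunit i (.inr t)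
    refine ⟨Q, ?_⟩
    simp only [TwoProverGame.successProb_eq_sum, hQ, Prod.mk.eta,
      sum_costMatrix_mul_correlationBlock, of_apply, ← hv, hvalue, bias]
  · rintro _ ⟨Q, rfl⟩
    rw [TwoProverGame.successProb_eq_objective]
    exact objective_conjunction_le G Q.feasibleSign_gramMatrix

lemma exists_feasibleSigma_objective_eq :
    ∃ P, FeasibleSigma P ∧ (conjunction G).objective P = ∏ i, (1 + (G i).bias) / 2 := by
  choose Γ hΓ _ hvalue using fun i => exists_isMaxOn_isCorrelation (G i).signedMatrix
  have hfeasible := feasibleSigma_correlationSolution hΓ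
  refine ⟨_, hfeasible, ?_⟩
  rw [TwoProverGame.objective_eq_sum _ (isSymm_of_posSemidef hfeasible.posSemidef)]
  simp only [bias, ← hvalue]
  exact sum_costMatrix_mul_correlationBlock G fun i => (Γ i).toBlocks₁₂

theorem isGreatest_objective_feasibleSigmaBar :
    IsGreatest ((conjunction G).objective '' {P | FeasibleSigmaBar P})
      (∏ i, (1 + (G i).bias) / 2) := by
  obtain ⟨P, hP, hvalue⟩ := exists_feasibleSigma_objective_eq G
  refine ⟨⟨P, hP.feasibleSigmaBar, hvalue⟩, ?_⟩
  rintro _ ⟨P', hP', rfl⟩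
  exact objective_conjunction_le G (FeasibleSigmaBar.feasibleSign hP')

theorem isGreatest_objective_feasibleSigma :
    IsGreatest ((conjunction G).objective '' {P | FeasibleSigma P})
      (∏ i, (1 + (G i).bias) / 2) := by
  obtain ⟨P, hP, hvalue⟩ := exists_feasibleSigma_objective_eq G
  refine ⟨⟨P, hP, hvalue⟩, ?_⟩
  rintro _ ⟨P', hP', rfl⟩
  exact objective_conjunction_le G (FeasibleSigma.feasibleSigmaBar hP').feasibleSign

end XORGame

/-- The first three conjuncts say that the suprema defining `ω_q`, `σ` and `σ̄` are maxima. -/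
theorem mainTheorem4 {n : ℕ} {S T : Fin n → Type*} [∀ i, Fintype (S i)] [∀ i, Fintype (T i)]
    (G : ∀ i, XORGame (S i) (T i)) :
    IsGreatest (Set.range (XORGame.conjunction G).successProb)
        (XORGame.conjunction G).quantumValue ∧
      IsGreatest ((XORGame.conjunction G).objective '' {P | FeasibleSigma P})
        (XORGame.conjunction G).sigma ∧
      IsGreatest ((XORGame.conjunction G).objective '' {P | FeasibleSigmaBar P})
        (XORGame.conjunction G).sigmaBar ∧
      (XORGame.conjunction G).quantumValue = (XORGame.conjunction G).sigma ∧
      (XORGame.conjunction G).sigma = (XORGame.conjunction G).sigmaBar := by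
  have hquantum := XORGame.isGreatest_successProb_conjunction G
  have hsigma := XORGame.isGreatest_objective_feasibleSigma G
  have hsigmaBar := XORGame.isGreatest_objective_feasibleSigmaBar G
  have hquantum_eq : (XORGame.conjunction G).quantumValue = _ := hquantum.csSup_eq
  have hsigma_eq : (XORGame.conjunction G).sigma = _ := hsigma.csSup_eq
  have hsigmaBar_eq : (XORGame.conjunction G).sigmaBar = _ := hsigmaBar.csSup_eq
  rw [hquantum_eq, hsigma_eq, hsigmaBar_eq]
  exact ⟨hquantum, hsigma, hsigmaBar, rfl, rfl⟩
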